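/- Conventions. $\omega^\omega$ is Baire space, and $\subseteq$ in $g\colon\subseteq A\to B$ marks a partial function (with arbitrary domain), which is called continuous if it is continuous on its domain with the subspace topology; equality of partial functions includes equality of domains. An admissible representation of a topological space $X$ is a continuous surjective partial function $\rho_X\colon\subseteq\omega^\omega\to X$ such that for every partial continuous $g\colon\subseteq\omega^\omega\to X$ there is a partial continuous $G\colon\subseteq\omega^\omega\to\omega^\omega$ with $g=\rho_X\circ G$. For a countable ordinal $\alpha$, fix an injective encoding $\langle\cdot\rangle_\alpha$ of the ordinals less than $\alpha$ as natural numbers, let $\langle\beta\rangle_\alpha\diamond\xi$ be $\xi\in\omega^\omega$ with $\langle\beta\rangle_\alpha$ prepended, and let $\langle\zeta_n\rangle_{n\in\omega}\in\omega^\omega$ be the code (via the Cantor pairing function) of a sequence $(\zeta_n)_{n\in\omega}$ in $\omega^\omega$. The partial function $j_\alpha\colon\subseteq\omega^\omega\to\omega^\omega$ has as domain all $\langle\langle\beta_n\rangle_\alpha\diamond\xi_n\rangle_{n\in\omega}$ such that for all $n$, $\alpha>\beta_n\ge\beta_{n+1}$ and ($\xi_n\ne\xi_{n+1}\Rightarrow\beta_n\neq\beta_{n+1}$),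 and its value there is $\lim_n\xi_n$. If $X,Y$ have representations $\rho_X,\rho_Y$, a function $f\colon X\to Y$ is $j_\alpha$-realizable if there is a partial continuous $F\colon\subseteq\omega^\omega\to\omega^\omega$ with $f\circ\rho_X=\rho_Y\circ j_\alpha\circ F$. For $f\colon X\to Y$ let $\mathcal L_0(f)=X$; let $\mathcal L_{\beta+1}(f)$ be the closure in $X$ of the set of $x\in\mathcal L_\beta(f)$ at which $f|_{\mathcal L_\beta(f)}$ is discontinuous; and $\mathcal L_\beta(f)=\bigcap_{\gamma<\beta}\mathcal L_\gamma(f)$ for limit $\beta$. Then $Lev(f)$ is the least $\beta$ with $\mathcal L_\beta(f)=\emptyset$ if there is one, and $Lev(f)=\infty$ otherwise. Finally, $f$ is $\mathcal D_\alpha$-piecewise continuous if there are open sets $U_\beta\subseteq X$ ($\beta<\alpha$) such that, with $\mathcal D_\alpha(U_\beta)=U_\beta\setminus\bigcup_{\gamma<\beta}U_\gamma$, we have $X=\bigcup_{\beta<\alpha}\mathcal D_\alpha(U_\beta)$ and each restriction $f|_{\mathcal D_\alpha(U_\beta)}$ is continuous. Theorem. Let $X$ and $Y$ be countably based $T_0$-spaces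 with admissible representations $\rho_X$ and $\rho_Y$, let $f\colon X\to Y$ be a (total) function, and let $\alpha$ be a countable ordinal. Then $f$ is $j_\alpha$-realizable if and only if $Lev(f)\le\alpha$, and $Lev(f)\le\alpha$ if and only if $f$ is $\mathcal D_\alpha$-piecewise continuous. -/

import Mathlib

open Set Filter Topology

universe u v

namespace LevelsOfDiscontinuity

/-! ### Represented spaces, admissibility and realizability -/

/-- Baire space `ω^ω`, with the product topology. Partial functions are `PFun`s (`→.`), and
equations between partial functions and their composites include equality of domains. -/
abbrev Baire : Type := ℕ → ℕ

/-- A partial function, with arbitrary domain, is continuous if it is continuous on its domain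
with the subspace topology. -/
def PartialContinuous {A : Type u} {B : Type v} [TopologicalSpace A] [TopologicalSpace B]
    (f : A →. B) : Prop :=
  Continuous f.asSubtype

/-- An admissible representation of a topological space `X`: a continuous surjective partial
function `ρ : ⊆ ω^ω → X` such that every partial continuous `g : ⊆ ω^ω → X` is of the form `ρ ∘ F`
for some partial continuous `F : ⊆ ω^ω → ω^ω`. -/
structure IsAdmissible {X : Type u} [TopologicalSpace X] (ρ : Baire →. X) : Prop where
  surjective : ∀ x : X, ∃ p : Baire, x ∈ ρ p
  continuous : PartialContinuous ρ
  lift : ∀ g : Baire →. X, PartialContinuous g →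
    ∃ F : Baire →. Baire, PartialContinuous F ∧ g = ρ.comp F

/-- `F ⊢ f`, i.e. `f ∘ ρX = ρY ∘ F` as partial functions. -/
def Realizes {X : Type u} {Y : Type v} (ρX : Baire →. X) (ρY : Baire →. Y)
    (F : Baire →. Baire) (f : X → Y) : Prop :=
  (f : X →. Y).comp ρX = ρY.comp F

/-- `f` is `j`-realizable: there is a partial continuous `F` with `j ∘ F ⊢ f`. -/
def JRealizable {X : Type u} {Y : Type v} (ρX : Baire →. X) (ρY : Baire →. Y)
    (j : Baire →. Baire) (f : X → Y) : Prop :=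
  ∃ F : Baire →. Baire, PartialContinuous F ∧ Realizes ρX ρY (j.comp F) f

/-! ### The jump operators `j_α` -/

/-- The `n`-th term of the sequence of elements of Baire space coded by `q`; here
`⟨ζ_n⟩_n` is the element with value `ζ_n k` at the Cantor pair of `n` and `k`. -/
def term (q : Baire) (n : ℕ) : Baire := fun k => q (Nat.pair n k)

/-- The `n`-th guess `ξ_n` coded by `q`: the `n`-th term without its first entry. -/
def guess (q : Baire) (n : ℕ) : Baire := fun k => term q n (k + 1)

/-- The domain of `j_α`: those `q = ⟨⟨β_n⟩_α ⋄ ξ_n⟩_n` for which the ordinals `β_n < α` never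
increase, and properly decrease whenever the guess `ξ_n` changes. The encoding `⟨·⟩_α` of the
ordinals below `α` by natural numbers is `enc`. -/
def jumpDom (α : Ordinal.{u}) (enc : Iio α → ℕ) : Set Baire :=
  {q | ∃ β : ℕ → Iio α, (∀ n, term q n 0 = enc (β n)) ∧ (∀ n, β (n + 1) ≤ β n) ∧
    ∀ n, guess q n ≠ guess q (n + 1) → β n ≠ β (n + 1)}

/-- The jump operator `j_α : ⊆ ω^ω → ω^ω`, `j_α ⟨⟨β_n⟩_α ⋄ ξ_n⟩_n = lim_n ξ_n`. -/
noncomputable def jump (α : Ordinal.{u}) (enc : Iio α → ℕ) : Baire →. Baire := fun q =>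
  { Dom := q ∈ jumpDom α enc
    get := fun _ => limUnder atTop (guess q) }

/-- On the domain of `j_α` the guesses are eventually constant. -/
theorem exists_guess_eq {α : Ordinal.{u}} {enc : Iio α → ℕ} {q : Baire}
    (hq : q ∈ jumpDom α enc) : ∃ N, ∀ n, N ≤ n → guess q n = guess q N := by
  obtain ⟨β, -, hβ, hξ⟩ := hq
  have hanti : Antitone β := antitone_nat_of_succ_le hβ
  obtain ⟨N, hN⟩ := WellFounded.has_min (wellFounded_lt (α := Iio α)) (range β) ⟨_, 0, rfl⟩
  obtain ⟨⟨N, rfl⟩, hmin⟩ := hN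
  have hc : ∀ n, N ≤ n → β n = β N := fun n hn =>
    le_antisymm (hanti hn) (not_lt.1 (hmin _ ⟨n, rfl⟩))
  refine ⟨N, fun n hn => ?_⟩
  induction n, hn using Nat.le_induction with
  | base => rfl
  | succ n hn ih =>
    by_contra h
    exact hξ n (fun h' => h (h'.symm.trans ih)) ((hc n hn).trans (hc (n + 1) (by omega)).symm)

/-- On the domain of `j_α` the limit in its definition exists. -/
theorem tendsto_guess {α : Ordinal.{u}} {enc : Iio α → ℕ} {q : Baire}
    (hq : q ∈ jumpDom α enc) : Tendsto (guess q) atTop (𝓝 (limUnder atTop (guess q))) := by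
  obtain ⟨N, hN⟩ := exists_guess_eq hq
  exact tendsto_nhds_limUnder
    ⟨guess q N, tendsto_atTop_of_eventually_const (i₀ := N) hN⟩

/-! ### Hertling's level of discontinuity -/

/-- The sets `L_α(f)`: `L_0(f) = X`, `L_{α+1}(f)` is the closure in `X` of the set of points of
`L_α(f)` at which the restriction of `f` to `L_α(f)` is discontinuous, and one takes intersections
at limit ordinals. -/
noncomputable def discontSet {X : Type u} {Y : Type v} [TopologicalSpace X] [TopologicalSpace Y]
    (f : X → Y) (α : Ordinal.{u}) : Set X :=
  Ordinal.limitRecOn (motive := fun _ => Set X) α univ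
    (fun _ L => closure {x | x ∈ L ∧ ¬ ContinuousWithinAt f L x})
    (fun β _ L => ⋂ (γ : Ordinal.{u}) (h : γ < β), L γ h)

section

variable {X : Type u} {Y : Type v} [TopologicalSpace X] [TopologicalSpace Y]

theorem discontSet_zero (f : X → Y) : discontSet f 0 = univ :=
  Ordinal.limitRecOn_zero ..

theorem discontSet_add_one (f : X → Y) (α : Ordinal.{u}) :
    discontSet f (α + 1) =
      closure {x | x ∈ discontSet f α ∧ ¬ ContinuousWithinAt f (discontSet f α) x} :=
  Ordinal.limitRecOn_add_one ..

theorem discontSet_limit (f : X → Y) {α : Ordinal.{u}} (hα : Order.IsSuccLimit α) :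
    discontSet f α = ⋂ (γ : Ordinal.{u}) (_ : γ < α), discontSet f γ :=
  Ordinal.limitRecOn_limit _ _ _ _ hα

end

open Classical in
/-- The level `Lev(f)`: the least `α` with `L_α(f) = ∅`, or `∞` if there is none. -/
noncomputable def Lev {X : Type u} {Y : Type v} [TopologicalSpace X] [TopologicalSpace Y]
    (f : X → Y) : WithTop Ordinal.{u} :=
  if ∃ α : Ordinal.{u}, discontSet f α = ∅ then
    ((sInf {α : Ordinal.{u} | discontSet f α = ∅} : Ordinal.{u}) : WithTop Ordinal.{u})
  else ⊤

/-! ### Piecewise continuity -/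

/-- `D_α(U_β) = U_β \ ⋃_{γ < β} U_γ`. -/
def diffPiece {X : Type u} {α : Ordinal.{u}} (U : Iio α → Set X) (β : Iio α) : Set X :=
  U β \ ⋃ (γ : Iio α) (_ : γ < β), U γ

/-- `f` is `D_α`-piecewise continuous. -/
def DPiecewiseContinuous {X : Type u} {Y : Type v} [TopologicalSpace X] [TopologicalSpace Y]
    (α : Ordinal.{u}) (f : X → Y) : Prop :=
  ∃ U : Iio α → Set X, (∀ β, IsOpen (U β)) ∧ (⋃ β, diffPiece U β) = univ ∧
    ∀ β, ContinuousOn f (diffPiece U β)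

end LevelsOfDiscontinuity

open LevelsOfDiscontinuity

/-! The ordinal shown by a realizer through `jump` marks the piece that the point is believed to lie
in, and a piece is essentially a difference of consecutive levels.

Levels and pieces. The complements of the L_{β+1} serve as the U_β. Conversely, L_β misses U_γ for
all γ < β by induction, since L_γ ∩ U_γ lies in the piece γ, where f is continuous.

Realizer to pieces (`JRealizable.dPiecewiseContinuous`). U_β consists of the points with a name on
which some ordinal ≤ β is shown; it is open if the names come from an open representation, which
factors through ρX by admissibility. On the piece β, a shown β is never undercut, so the guess made
with it is final and depends continuously on the name.

Pieces to realizer (`DPiecewiseContinuous.jRealizable`). Show the least β such that the prefix read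
so far forces the point into U_β, and guess by a lift of f ∘ ρX on the piece β. This lift is
partial, but a missing digit may be filled arbitrarily once the prefix forces the point into an
earlier U_γ, because β is then not final (`exists_descending_guesses`). -/

namespace LevelsOfDiscontinuity

/-! ### Levels of discontinuity versus piecewise continuity -/

section Levels

variable {X : Type u} {Y : Type v} [TopologicalSpace X] [TopologicalSpace Y]

theorem isClosed_discontSet (f : X → Y) (α : Ordinal.{u}) : IsClosed (discontSet f α) := by
  induction α using Ordinal.limitRecOn with
  | zero => rw [discontSet_zero]; exact isClosed_univ
  | add_one α _ => rw [discontSet_add_one]; exact isClosed_closure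
  | limit α hα ih =>
    rw [discontSet_limit f hα]
    exact isClosed_iInter fun γ => isClosed_iInter fun h => ih γ h

theorem discontSet_add_one_subset (f : X → Y) (α : Ordinal.{u}) :
    discontSet f (α + 1) ⊆ discontSet f α := by
  rw [discontSet_add_one]
  exact closure_minimal (fun x hx => hx.1) (isClosed_discontSet f α)

theorem antitone_discontSet (f : X → Y) : Antitone (discontSet f) := by
  intro β α h
  induction α using Ordinal.limitRecOn with
  | zero => rw [nonpos_iff_eq_zero.1 h]
  | add_one α ih =>
    rcases h.eq_or_lt with rfl | h
    · exact subset_rfl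
    · exact (discontSet_add_one_subset f α).trans (ih (Order.lt_add_one_iff.1 h))
  | limit α hα ih =>
    rcases h.eq_or_lt with rfl | h
    · exact subset_rfl
    · rw [discontSet_limit f hα]
      exact iInter₂_subset β h

theorem lev_le_iff (f : X → Y) (α : Ordinal.{u}) :
    Lev f ≤ (α : WithTop Ordinal.{u}) ↔ discontSet f α = ∅ := by
  classical
  unfold Lev
  split_ifs with h
  · rw [WithTop.coe_le_coe]
    refine ⟨fun hle => ?_, fun hα => csInf_le' hα⟩
    have := csInf_mem (s := {α : Ordinal.{u} | discontSet f α = ∅}) h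
    exact subset_empty_iff.1 ((antitone_discontSet f hle).trans this.subset)
  · simp only [top_le_iff, WithTop.coe_ne_top, false_iff]
    exact fun hα => h ⟨α, hα⟩

/-- Avoids splitting into zero, successor and limit ordinals when a point is located by the least γ
with x outside L_{γ+1}. -/
theorem mem_discontSet_of_forall_lt {f : X → Y} {x : X} {β : Ordinal.{u}}
    (h : ∀ γ < β, x ∈ discontSet f (γ + 1)) : x ∈ discontSet f β := by
  induction β using Ordinal.limitRecOn with
  | zero => rw [discontSet_zero]; trivial
  | add_one β _ => exact h β (Order.lt_add_one_iff.2 le_rfl)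
  | limit β hβ _ =>
    rw [discontSet_limit f hβ]
    exact mem_iInter₂.2 fun γ hγ => discontSet_add_one_subset f γ (h γ hγ)

theorem dPiecewiseContinuous_of_discontSet_eq_empty {f : X → Y} {α : Ordinal.{u}}
    (h : discontSet f α = ∅) : DPiecewiseContinuous α f := by
  refine ⟨fun β => (discontSet f (β + 1))ᶜ, fun β => (isClosed_discontSet f _).isOpen_compl,
    eq_univ_of_forall fun x => ?_, fun β => ?_⟩
  · have hne : ∃ γ < α, x ∉ discontSet f (γ + 1) := by
      by_contra! hx
      have := mem_discontSet_of_forall_lt hx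
      simp [h] at this
    obtain ⟨γ, ⟨hγ, hxγ⟩, hmin⟩ := WellFounded.has_min (wellFounded_lt (α := Ordinal.{u}))
      {γ | γ < α ∧ x ∉ discontSet f (γ + 1)} hne
    refine mem_iUnion.2 ⟨⟨γ, hγ⟩, hxγ, ?_⟩
    simp only [mem_iUnion, not_exists]
    exact fun δ hδ hx => hmin δ ⟨δ.2, hx⟩ hδ
  · have hsub : diffPiece (fun β : Iio α => (discontSet f (β + 1))ᶜ) β ⊆ discontSet f β := by
      intro x hx
      refine mem_discontSet_of_forall_lt fun γ hγ => ?_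
      by_contra hxγ
      exact hx.2 (mem_iUnion₂.2 ⟨⟨γ, hγ.trans β.2⟩, hγ, hxγ⟩)
    intro x hx
    refine ContinuousWithinAt.mono ?_ hsub
    by_contra hc
    refine hx.1 ?_
    rw [discontSet_add_one]
    exact subset_closure ⟨hsub hx, hc⟩

theorem DPiecewiseContinuous.discontSet_eq_empty {f : X → Y} {α : Ordinal.{u}}
    (h : DPiecewiseContinuous α f) : discontSet f α = ∅ := by
  obtain ⟨U, hU, hcov, hf⟩ := h
  have key : ∀ β ≤ α, ∀ γ : Iio α, (γ : Ordinal.{u}) < β → Disjoint (discontSet f β) (U γ) := by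
    intro β
    induction β using Ordinal.limitRecOn with
    | zero => exact fun _ γ hγ => absurd hγ not_lt_zero
    | add_one β ih =>
      intro hβ γ hγ
      have hβα : β < α := Order.add_one_le_iff.1 hβ
      rcases (Order.lt_add_one_iff.1 hγ).lt_or_eq with hlt | rfl
      · exact (ih hβα.le γ hlt).mono_left (discontSet_add_one_subset f β)
      · rw [discontSet_add_one]
        refine Disjoint.closure_left (disjoint_left.2 ?_) (hU γ)
        rintro x ⟨hx, hd⟩ hxU
        -- By induction L_γ avoids all earlier U_δ. As U_γ is open, continuity on this intersection
        -- is continuity of the restriction to L_γ at its points.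
        have hsub : discontSet f γ ∩ U γ ⊆ diffPiece U γ := by
          rintro y ⟨hy, hyU⟩
          refine ⟨hyU, ?_⟩
          simp only [mem_iUnion, not_exists]
          exact fun δ hδ hyδ => disjoint_left.1 (ih hβα.le δ hδ) hy hyδ
        exact hd ((continuousWithinAt_inter ((hU γ).mem_nhds hxU)).1
          ((hf γ x (hsub ⟨hx, hxU⟩)).mono hsub))
    | limit β hβ ih =>
      intro hβα γ hγ
      have hγ' : (γ : Ordinal.{u}) + 1 < β := hβ.add_one_lt hγ
      exact (ih _ hγ' (hγ'.le.trans hβα) γ (Order.lt_add_one_iff.2 le_rfl)).mono_left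
        (antitone_discontSet f hγ'.le)
  refine eq_empty_of_forall_notMem fun x hx => ?_
  obtain ⟨β, hβ⟩ := mem_iUnion.1 (hcov.symm ▸ mem_univ x : x ∈ ⋃ β, diffPiece U β)
  exact disjoint_left.1 (key α le_rfl β β.2) hx hβ.1

theorem lev_le_iff_dPiecewiseContinuous (f : X → Y) (α : Ordinal.{u}) :
    Lev f ≤ (α : WithTop Ordinal.{u}) ↔ DPiecewiseContinuous α f :=
  (lev_le_iff f α).trans
    ⟨dPiecewiseContinuous_of_discontSet_eq_empty, DPiecewiseContinuous.discontSet_eq_empty⟩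

end Levels

/-! ### Partial functions through their graphs -/

section PartialFunctions

variable {A : Type u} {B : Type v}

/-- The partial function whose graph is `P`, if `P` is functional. -/
noncomputable def pfunOfGraph (P : A → B → Prop) : A →. B := fun a =>
  { Dom := ∃ b, P a b
    get := fun h => h.choose }

theorem mem_pfunOfGraph {P : A → B → Prop} (hP : ∀ a b b', P a b → P a b' → b = b') {a : A}
    {b : B} : b ∈ pfunOfGraph P a ↔ P a b := by
  constructor
  · rintro ⟨h, rfl⟩
    exact h.choose_spec
  · intro h
    have h' : ∃ b, P a b := ⟨b, h⟩
    exact ⟨h', hP a _ _ h'.choose_spec h⟩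

theorem mem_comp_iff {C : Type*} {g : B →. C} {f : A →. B} {a : A} {c : C} :
    c ∈ g.comp f a ↔ ∃ b ∈ f a, c ∈ g b := by
  rw [PFun.comp_apply]
  exact Part.mem_bind_iff

theorem partialContinuous_iff [TopologicalSpace A] [TopologicalSpace B] {f : A →. B} :
    PartialContinuous f ↔
      ∀ U : Set B, IsOpen U → ∃ W : Set A, IsOpen W ∧ ∀ a, ∀ b ∈ f a, (a ∈ W ↔ b ∈ U) := by
  unfold PartialContinuous
  rw [continuous_def]
  refine forall₂_congr fun U _ => ?_
  rw [isOpen_induced_iff]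
  refine exists_congr fun W => and_congr_right fun _ => ⟨fun h a b hb => ?_, fun h => ?_⟩
  · obtain ⟨ha, rfl⟩ := hb
    exact Set.ext_iff.1 h ⟨a, ha⟩
  · ext ⟨a, ha⟩
    exact h a _ ⟨ha, rfl⟩

theorem PartialContinuous.comp {C : Type*} [TopologicalSpace A] [TopologicalSpace B]
    [TopologicalSpace C] {g : B →. C} {f : A →. B} (hg : PartialContinuous g)
    (hf : PartialContinuous f) : PartialContinuous (g.comp f) := by
  rw [partialContinuous_iff] at *
  intro U hU
  obtain ⟨V, hV, hVU⟩ := hg U hU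
  obtain ⟨W, hW, hWV⟩ := hf V hV
  refine ⟨W, hW, fun a c hc => ?_⟩
  obtain ⟨b, hb, hbc⟩ := mem_comp_iff.1 hc
  exact (hWV a b hb).trans (hVU b c hbc)

theorem realizes_iff {X : Type u} {Y : Type v} {ρX : Baire →. X} {ρY : Baire →. Y}
    {F : Baire →. Baire} {f : X → Y} :
    Realizes ρX ρY F f ↔ ∀ p y, (∃ x ∈ ρX p, f x = y) ↔ ∃ q ∈ F p, y ∈ ρY q := by
  have : ∀ p y, y ∈ (f : X →. Y).comp ρX p ↔ ∃ x ∈ ρX p, f x = y := fun p y => by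
    rw [mem_comp_iff]
    simp [eq_comm]
  refine ⟨fun h p y => ?_, fun h => PFun.ext fun p y => ?_⟩
  · rw [← this, h, mem_comp_iff]
  · rw [this, h, mem_comp_iff]

end PartialFunctions

/-! ### The jump operator as an eventually constant limit -/

section Jump

variable {α : Ordinal.{u}} {enc : Iio α → ℕ}

/-- The ordinals stabilise by well-foundedness and freeze the guesses, so the limit is a value
attained from some stage on. -/
theorem mem_jump_iff {q w : Baire} :
    w ∈ jump α enc q ↔ q ∈ jumpDom α enc ∧ ∃ N, ∀ n, N ≤ n → guess q n = w := by
  constructor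
  · rintro ⟨h, rfl⟩
    obtain ⟨N, hN⟩ := exists_guess_eq h
    refine ⟨h, N, fun n hn => (hN n hn).trans ?_⟩
    exact tendsto_nhds_unique (tendsto_atTop_of_eventually_const (i₀ := N) hN) (tendsto_guess h)
  · rintro ⟨h, N, hN⟩
    exact ⟨h, tendsto_nhds_unique (tendsto_guess h)
      (tendsto_atTop_of_eventually_const (i₀ := N) hN)⟩

theorem continuous_term_apply (n k : ℕ) : Continuous fun q : Baire => term q n k :=
  continuous_apply _

theorem continuous_guess (n : ℕ) : Continuous fun q : Baire => guess q n :=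
  continuous_pi fun k => continuous_term_apply n (k + 1)

end Jump

/-! ### The standard open representation -/

section StandardRepresentation

variable {X : Type u} [TopologicalSpace X]

/-- A countably based `T₀` space is a continuous open image of a subspace of Baire space. -/
theorem exists_open_representation [T0Space X] [SecondCountableTopology X] [Nonempty X] :
    ∃ δ : Baire →. X, PartialContinuous δ ∧ (∀ x, ∃ p, x ∈ δ p) ∧
      ∀ W : Set Baire, IsOpen W → IsOpen {x | ∃ p ∈ W, x ∈ δ p} := by
  obtain ⟨b, hbc, -, hb⟩ := TopologicalSpace.exists_countable_basis X
  have hbne : b.Nonempty := by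
    obtain ⟨s, hs, -⟩ := hb.exists_subset_of_mem_open (mem_univ (Classical.arbitrary X)) isOpen_univ
    exact ⟨s, hs⟩
  obtain ⟨B, rfl⟩ := hbc.exists_eq_range hbne
  -- A name of x enumerates the indices of its basic neighbourhoods; T₀ makes the named point
  -- unique.
  have hmem : ∀ {p : Baire} {x : X},
      x ∈ pfunOfGraph (fun (p : Baire) (x : X) => range p = {i | x ∈ B i}) p ↔
        range p = {i | x ∈ B i} := by
    refine mem_pfunOfGraph fun p x y hx hy => ?_
    have hxy : ∀ i, x ∈ B i ↔ y ∈ B i := Set.ext_iff.1 (hx.symm.trans hy)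
    refine Inseparable.eq (hb.inseparable_iff.2 ?_)
    rintro _ ⟨i, rfl⟩
    exact hxy i
  generalize pfunOfGraph (fun (p : Baire) (x : X) => range p = {i | x ∈ B i}) = δ at hmem
  refine ⟨δ, partialContinuous_iff.2 fun U hU => ?_, fun x => ?_, fun W hW => ?_⟩
  · refine ⟨⋃ (i : ℕ) (_ : B i ⊆ U) (n : ℕ), {p | p n = i},
      isOpen_iUnion fun i => isOpen_iUnion fun _ => isOpen_iUnion fun n =>
        (isOpen_discrete {i}).preimage (continuous_apply n : Continuous fun p : Baire => p n),
      fun p x hx => ?_⟩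
    rw [hmem] at hx
    simp only [mem_iUnion, mem_ofPred_eq, exists_prop]
    constructor
    · rintro ⟨i, hi, n, rfl⟩
      exact hi (hx.subset (mem_range_self n))
    · intro hxU
      obtain ⟨_, ⟨i, rfl⟩, hxi, hi⟩ := hb.exists_subset_of_mem_open hxU hU
      exact ⟨i, hi, hx.superset hxi⟩
  · obtain ⟨_, ⟨i, rfl⟩, hxi, -⟩ := hb.exists_subset_of_mem_open (mem_univ x) isOpen_univ
    obtain ⟨p, hp⟩ := (to_countable {i | x ∈ B i}).exists_eq_range ⟨i, hxi⟩
    exact ⟨p, hmem.2 hp.symm⟩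
  · rw [isOpen_iff_mem_nhds]
    rintro x ⟨p, hpW, hpx⟩
    rw [hmem] at hpx
    obtain ⟨_, ⟨⟨q, N, rfl⟩, hpq, hN⟩⟩ :=
      (PiNat.isTopologicalBasis_cylinders (fun _ : ℕ => ℕ)).exists_subset_of_mem_open hpW hW
    rw [← PiNat.mem_cylinder_iff_eq.1 hpq] at hN
    have hopen : IsOpen (⋂ n ∈ Finset.range N, B (p n)) :=
      isOpen_biInter_finset fun n _ => hb.isOpen (mem_range_self _)
    refine mem_of_superset (hopen.mem_nhds (mem_iInter₂.2 fun n _ =>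
      hpx.subset (mem_range_self n))) fun y hy => ?_
    have hy' : ∀ n < N, y ∈ B (p n) := fun n hn => mem_iInter₂.1 hy n (Finset.mem_range.2 hn)
    obtain ⟨_, ⟨i, rfl⟩, hyi, -⟩ := hb.exists_subset_of_mem_open (mem_univ y) isOpen_univ
    obtain ⟨r, hr⟩ := (to_countable {i | y ∈ B i}).exists_eq_range ⟨i, hyi⟩
    -- The prefix of p lists only neighbourhoods of y, so following it by a full enumeration for y
    -- gives a name of y.
    refine ⟨fun n => if n < N then p n else r (n - N), hN fun n hn => if_pos hn, hmem.2 ?_⟩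
    refine Subset.antisymm ?_ ?_
    · rintro _ ⟨n, rfl⟩
      dsimp only
      split_ifs with hn
      · exact hy' n hn
      · exact hr.superset (mem_range_self _)
    · rw [hr]
      rintro _ ⟨n, rfl⟩
      exact ⟨N + n, by simp⟩

end StandardRepresentation

/-! ### From realizers to pieces -/

theorem JRealizable.dPiecewiseContinuous {X : Type u} {Y : Type v}
    [TopologicalSpace X] [T0Space X] [SecondCountableTopology X] [TopologicalSpace Y]
    {ρX : Baire →. X} (hρX : IsAdmissible ρX) {ρY : Baire →. Y} (hρY : PartialContinuous ρY)
    {f : X → Y} {α : Ordinal.{u}} {enc : Iio α → ℕ} (henc : Function.Injective enc)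
    (h : JRealizable ρX ρY (jump α enc) f) : DPiecewiseContinuous α f := by
  cases isEmpty_or_nonempty X
  · exact ⟨fun _ => ∅, fun _ => isOpen_empty, Subsingleton.elim _ _,
      fun β x => isEmptyElim x⟩
  obtain ⟨δ, hδ, hsurj, hopen⟩ := exists_open_representation (X := X)
  obtain ⟨G, hG, rfl⟩ := hρX.lift δ hδ
  obtain ⟨F₀, hF₀, hreal⟩ := h
  rw [realizes_iff] at hreal
  have hF := hF₀.comp hG
  set F := F₀.comp G with hFdef
  set δ := ρX.comp G with hδdef
  have hname : ∀ p, ∀ x ∈ δ p, ∃ q ∈ F p, q ∈ jumpDom α enc ∧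
      ∃ w, (∃ N, ∀ n, N ≤ n → guess q n = w) ∧ f x ∈ ρY w := by
    intro p x hx
    obtain ⟨r, hr, hx⟩ := mem_comp_iff.1 hx
    obtain ⟨w, hw, hfw⟩ := (hreal r (f x)).1 ⟨x, hx, rfl⟩
    obtain ⟨q, hq, hwq⟩ := mem_comp_iff.1 hw
    obtain ⟨hqd, hN⟩ := mem_jump_iff.1 hwq
    exact ⟨q, mem_comp_iff.2 ⟨r, hr, hq⟩, hqd, w, hN, hfw⟩
  rw [partialContinuous_iff] at hF hρY
  have hterm : ∀ n (s : Set ℕ), ∃ W : Set Baire, IsOpen W ∧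
      ∀ p, ∀ q ∈ F p, (p ∈ W ↔ term q n 0 ∈ s) := fun n s =>
    hF {q | term q n 0 ∈ s} ((isOpen_discrete s).preimage (continuous_term_apply n 0))
  choose W hWo hW using hterm
  -- `W n s` captures, on the domain of `F`, the names whose `n`-th shown code lies in `s`.
  let U : Iio α → Set X := fun β => {x | ∃ p ∈ ⋃ n, W n (enc '' Iic β), x ∈ δ p}
  have hUmem : ∀ {β : Iio α} {p q : Baire} {x : X} (n : ℕ), x ∈ δ p → q ∈ F p →
      (∃ γ ≤ β, term q n 0 = enc γ) → x ∈ U β := by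
    rintro β p q x n hx hq ⟨γ, hγ, hn⟩
    exact ⟨p, mem_iUnion.2 ⟨n, (hW n _ p q hq).2 ⟨γ, hγ, hn.symm⟩⟩, hx⟩
  refine ⟨U, fun β => hopen _ (isOpen_iUnion fun n => hWo n _), eq_univ_of_forall fun x => ?_,
    fun β x hx => ?_⟩
  · obtain ⟨p, hp⟩ := hsurj x
    obtain ⟨q, hq, ⟨b, hb, -⟩, -⟩ := hname p x hp
    obtain ⟨β, hβ, hmin⟩ := WellFounded.has_min (wellFounded_lt (α := Iio α)) {β | x ∈ U β}
      ⟨b 0, hUmem 0 hp hq ⟨b 0, le_rfl, hb 0⟩⟩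
    refine mem_iUnion.2 ⟨β, hβ, ?_⟩
    simp only [mem_iUnion, not_exists]
    exact fun γ hγ hx => hmin γ hx hγ
  · -- once `β` is shown, points of the piece never show a smaller ordinal
    have hstable : ∀ y ∈ diffPiece U β, ∀ p, y ∈ δ p → ∀ q ∈ F p, ∀ n, term q n 0 = enc β →
        f y ∈ ρY (guess q n) := by
      intro y hy p hp q hq n hn
      obtain ⟨q', hq', ⟨b, hb, hanti, hguess⟩, w, ⟨N, hN⟩, hfw⟩ := hname p y hp
      obtain rfl := Part.mem_unique hq hq'
      have hbn : b n = β := henc ((hb n).symm.trans hn)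
      have hconst : ∀ m, n ≤ m → b m = β := by
        intro m hm
        have hle : b m ≤ β := hbn ▸ antitone_nat_of_succ_le hanti hm
        by_contra hne
        exact hy.2 (mem_iUnion₂.2 ⟨b m, lt_of_le_of_ne hle hne,
          hUmem m hp hq ⟨b m, le_rfl, hb m⟩⟩)
      have hg : ∀ m, n ≤ m → guess q m = guess q n := by
        intro m hm
        induction m, hm using Nat.le_induction with
        | base => rfl
        | succ m hm ih =>
          by_contra hne
          exact hguess m (fun h => hne (h.symm.trans ih))
            ((hconst m hm).trans (hconst (m + 1) (by omega)).symm)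
      rw [← hg (max n N) (le_max_left _ _), hN _ (le_max_right _ _)]
      exact hfw
    obtain ⟨p, hpW, hp⟩ := hx.1
    obtain ⟨n, hpn⟩ := mem_iUnion.1 hpW
    obtain ⟨q, hq, -⟩ := hname p x hp
    obtain ⟨γ, hγ, hn⟩ := (hW n _ p q hq).1 hpn
    have hγβ : γ = β := by
      by_contra hne
      exact hx.2 (mem_iUnion₂.2 ⟨γ, lt_of_le_of_ne hγ hne, hUmem n hp hq ⟨γ, le_rfl, hn.symm⟩⟩)
    subst hγβ
    rw [ContinuousWithinAt, (nhds_basis_opens (f x)).tendsto_right_iff]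
    rintro V ⟨hxV, hV⟩
    obtain ⟨V', hV', hVV'⟩ := hρY V hV
    obtain ⟨T, hT, hTV⟩ := hF {q | guess q n ∈ V'} (hV'.preimage (continuous_guess n))
    -- Openness of δ turns names close to p, which also show γ at stage n and whose guess lies in
    -- V', into a neighbourhood of x.
    have hO := hopen (W n {enc γ} ∩ T) ((hWo _ _).inter hT)
    refine mem_nhdsWithin.2 ⟨_, hO, ⟨p, ⟨(hW n _ p q hq).2 hn.symm, (hTV p q hq).2 ?_⟩, hp⟩, ?_⟩
    · exact (hVV' _ _ (hstable x hx p hp q hq n hn.symm)).2 hxV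
    · rintro y ⟨⟨p', ⟨hp'W, hp'T⟩, hp'⟩, hy⟩
      obtain ⟨q', hq', -⟩ := hname p' y hp'
      exact (hVV' _ _ (hstable y hy p' hp' q' hq' n ((hW n _ p' q' hq').1 hp'W))).1
        ((hTV p' q' hq').1 hp'T)

/-! ### Search along the prefixes of a name -/

section Search

open PiNat

/-- The cylinder of length `n` around a point of Baire space. -/
abbrev cyl (p : Baire) (n : ℕ) : Set Baire := cylinder p n

theorem exists_cyl_subset {p : Baire} {W : Set Baire} (hW : IsOpen W) (hp : p ∈ W) :
    ∃ n, cyl p n ⊆ W := by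
  obtain ⟨_, ⟨⟨q, n, rfl⟩, hpq, hn⟩⟩ :=
    (isTopologicalBasis_cylinders (fun _ : ℕ => ℕ)).exists_subset_of_mem_open hp hW
  exact ⟨n, (mem_cylinder_iff_eq.1 hpq).trans_subset hn⟩

theorem cyl_eq_of_mem {p p' : Baire} {m n : ℕ} (h : p' ∈ cyl p n) (hm : m ≤ n) :
    cyl p' m = cyl p m :=
  mem_cylinder_iff_eq.1 (cylinder_anti p hm h)

/-- The length of the shortest cylinder around `p` with property `P`. -/
noncomputable def stage (P : Set Baire → Prop) (p : Baire) : ℕ :=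
  sInf {t | P (cyl p t)}

theorem stage_spec {P : Set Baire → Prop} {p : Baire} (h : ∃ t, P (cyl p t)) :
    P (cyl p (stage P p)) :=
  Nat.sInf_mem (s := {t | P (cyl p t)}) h

/-- The search inspects only a prefix of p, so every point sharing that prefix stops at the same
stage. -/
theorem stage_eq_of_mem {P : Set Baire → Prop} {p p' : Baire} (h : ∃ t, P (cyl p t)) {n : ℕ}
    (hn : stage P p ≤ n) (hp' : p' ∈ cyl p n) : stage P p' = stage P p := by
  have h' : P (cyl p' (stage P p)) := by
    rw [cyl_eq_of_mem hp' hn]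
    exact stage_spec h
  have hle : stage P p' ≤ stage P p := Nat.sInf_le h'
  refine le_antisymm hle (Nat.sInf_le ?_)
  have := stage_spec ⟨_, h'⟩
  rwa [cyl_eq_of_mem hp' (hle.trans hn)] at this

variable {ι : Type v} [LinearOrder ι] [WellFoundedLT ι] [Nonempty ι]

/-- `C` decides the `k`-th digit of the values of `G`. -/
def Decides (G : Baire →. Baire) (k : ℕ) (C : Set Baire) : Prop :=
  ∀ p ∈ C, ∀ p' ∈ C, ∀ q ∈ G p, ∀ q' ∈ G p', q k = q' k

open Classical in
/-- The `k`-th digit of some value of `G` on `C`, or `0`. -/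
noncomputable def digit (G : Baire →. Baire) (k : ℕ) (C : Set Baire) : ℕ :=
  if h : ∃ q : Baire, ∃ p ∈ C, q ∈ G p then h.choose k else 0

theorem digit_eq {G : Baire →. Baire} {k : ℕ} {C : Set Baire} (hC : Decides G k C) {p q : Baire}
    (hp : p ∈ C) (hq : q ∈ G p) : digit G k C = q k := by
  have h : ∃ q : Baire, ∃ p ∈ C, q ∈ G p := ⟨q, p, hp, hq⟩
  obtain ⟨p', hp', hq'⟩ := h.choose_spec
  rw [digit, dif_pos h]
  exact hC _ hp' _ hp _ hq' _ hq

theorem exists_decides {G : Baire →. Baire} (hG : PartialContinuous G) {p q : Baire}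
    (hq : q ∈ G p) (k : ℕ) : ∃ t, Decides G k (cyl p t) := by
  obtain ⟨W, hW, h⟩ := partialContinuous_iff.1 hG {r | r k = q k}
    ((isOpen_discrete {q k}).preimage (continuous_apply k : Continuous fun r : Baire => r k))
  obtain ⟨t, ht⟩ := exists_cyl_subset hW ((h p q hq).2 rfl)
  refine ⟨t, fun p₁ hp₁ p₂ hp₂ q₁ hq₁ q₂ hq₂ => ?_⟩
  have h₁ : q₁ k = q k := (h p₁ q₁ hq₁).1 (ht hp₁)
  have h₂ : q₂ k = q k := (h p₂ q₂ hq₂).1 (ht hp₂)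
  rw [h₁, h₂]

/-- Given open sets `W i` covering `D` and partial continuous functions `G i`, one can continuously
produce indices `b p n` descending to the least `i` with `p ∈ W i`, together with total guesses
`ξ p (b p n)` the last of which is `G i p`. -/
theorem exists_descending_guesses {D : Set Baire} {W : ι → Set Baire} (hW : ∀ i, IsOpen (W i))
    (hD : ∀ p ∈ D, ∃ i, p ∈ W i) {G : ι → Baire →. Baire} (hG : ∀ i, PartialContinuous (G i))
    (hdom : ∀ p ∈ D, ∀ i, p ∈ W i → (∀ j < i, p ∉ W j) → (G i p).Dom) :
    ∃ (b : Baire → ℕ → ι) (ξ : Baire → ι → Baire),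
      (∀ p ∈ D, Antitone (b p)) ∧
      (∀ p ∈ D, ∃ N i, (∀ n, N ≤ n → b p n = i) ∧ p ∈ W i ∧ (∀ j < i, p ∉ W j) ∧
        ξ p i ∈ G i p) ∧
      ∀ p ∈ D, ∀ n k, ∃ t, ∀ p' ∈ cyl p t, b p' n = b p n ∧
        ξ p' (b p' n) k = ξ p (b p n) k := by
  obtain ⟨i₀⟩ := ‹Nonempty ι›
  have hmin : ∀ s : Set ι, ∃ i, s.Nonempty → i ∈ s ∧ ∀ j ∈ s, i ≤ j := by
    intro s
    by_cases hs : s.Nonempty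
    · obtain ⟨i, hi, h⟩ := WellFounded.has_min (wellFounded_lt (α := ι)) s hs
      exact ⟨i, fun _ => ⟨hi, fun j hj => not_lt.1 (h j hj)⟩⟩
    · exact ⟨i₀, fun h => absurd h hs⟩
  choose m hm using hmin
  let S : Set Baire → Set ι := fun C => {i | C ⊆ W i}
  -- Output starts only when the prefix already lies in some `W i`, so on `D` the default value of
  -- `m` is never shown.
  let t₀ : Baire → ℕ := stage fun C => (S C).Nonempty
  let b : Baire → ℕ → ι := fun p n => m (S (cyl p (t₀ p + n)))
  -- The second alternative ends the search when p is outside the domain of `G i`. It cannot occur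
  -- at the final index, so the last guess is correct.
  let Q : ι → ℕ → Set Baire → Prop := fun i k C => Decides (G i) k C ∨ ∃ j < i, C ⊆ W j
  let ξ : Baire → ι → Baire := fun p i k => digit (G i) k (cyl p (stage (Q i k) p))
  have hex : ∀ p ∈ D, ∃ t, (S (cyl p t)).Nonempty := fun p hp => by
    obtain ⟨i, hi⟩ := hD p hp
    obtain ⟨t, ht⟩ := exists_cyl_subset (hW i) hi
    exact ⟨t, i, ht⟩
  have hS : ∀ p {s t : ℕ}, s ≤ t → S (cyl p s) ⊆ S (cyl p t) := fun p s t hst i hi =>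
    (cylinder_anti p hst).trans hi
  have hne : ∀ p ∈ D, ∀ n, (S (cyl p (t₀ p + n))).Nonempty := fun p hp n =>
    Set.Nonempty.mono (hS p (Nat.le_add_right _ _))
      (stage_spec (P := fun C => (S C).Nonempty) (hex p hp))
  have hbW : ∀ p ∈ D, ∀ n, p ∈ W (b p n) := fun p hp n =>
    (hm _ (hne p hp n)).1 (self_mem_cylinder _ _)
  have hlast : ∀ p ∈ D, ∀ i, p ∈ W i → (∀ j < i, p ∉ W j) → ∀ k, ∃ t, Decides (G i) k (cyl p t) :=
    fun p hp i hi hlt => exists_decides (hG i) (Part.get_mem (hdom p hp i hi hlt))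
  have hQ : ∀ p ∈ D, ∀ i, p ∈ W i → ∀ k, ∃ t, Q i k (cyl p t) := by
    intro p hp i hi k
    by_cases h : ∃ j < i, p ∈ W j
    · obtain ⟨j, hji, hj⟩ := h
      obtain ⟨t, ht⟩ := exists_cyl_subset (hW j) hj
      exact ⟨t, Or.inr ⟨j, hji, ht⟩⟩
    · push Not at h
      obtain ⟨t, ht⟩ := hlast p hp i hi h k
      exact ⟨t, Or.inl ht⟩
  refine ⟨b, ξ, fun p hp s t hst => ?_, fun p hp => ?_, fun p hp n k => ?_⟩
  · exact (hm _ (hne p hp t)).2 _ (hS p (by omega) (hm _ (hne p hp s)).1)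
  · obtain ⟨i, hi, hlt⟩ := WellFounded.has_min (wellFounded_lt (α := ι)) {i | p ∈ W i} (hD p hp)
    have hlt' : ∀ j < i, p ∉ W j := fun j hj hpj => hlt j hpj hj
    obtain ⟨N, hN⟩ := exists_cyl_subset (hW i) hi
    refine ⟨N, i, fun n hn => le_antisymm ?_ (not_lt.1 (hlt _ (hbW p hp n))), hi, hlt', ?_⟩
    · exact (hm _ (hne p hp n)).2 _ (hS p (by omega : N ≤ t₀ p + n) hN)
    · have hq := Part.get_mem (hdom p hp i hi hlt')
      convert hq
      funext k
      rcases stage_spec (hQ p hp i hi k) with h | ⟨j, hj, h⟩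
      · exact digit_eq h (self_mem_cylinder _ _) hq
      · exact absurd (h (self_mem_cylinder _ _)) (hlt' j hj)
  · refine ⟨max (t₀ p + n) (stage (Q (b p n) k) p), fun p' hp' => ?_⟩
    have ht : t₀ p' = t₀ p := stage_eq_of_mem (hex p hp)
      ((Nat.le_add_right (t₀ p) n).trans (le_max_left _ _)) hp'
    have hb : b p' n = b p n := by
      simp only [b]
      rw [ht, cyl_eq_of_mem hp' (le_max_left _ _)]
    refine ⟨hb, ?_⟩
    rw [hb]
    simp only [ξ]
    rw [stage_eq_of_mem (hQ p hp _ (hbW p hp n) k) (le_max_right _ _) hp',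
      cyl_eq_of_mem hp' (le_max_right _ _)]

end Search

/-! ### From pieces to realizers -/

theorem DPiecewiseContinuous.jRealizable {X : Type u} {Y : Type v}
    [TopologicalSpace X] [TopologicalSpace Y]
    {ρX : Baire →. X} (hρX : PartialContinuous ρX) {ρY : Baire →. Y} (hρY : IsAdmissible ρY)
    {f : X → Y} {α : Ordinal.{u}} (enc : Iio α → ℕ)
    (h : DPiecewiseContinuous α f) : JRealizable ρX ρY (jump α enc) f := by
  obtain ⟨U, hU, hcov, hf⟩ := h
  choose W hWo hW using fun β => partialContinuous_iff.1 hρX (U β) (hU β)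
  have hpiece : ∀ {β x}, x ∈ diffPiece U β ↔ x ∈ U β ∧ ∀ γ < β, x ∉ U γ := by
    simp [diffPiece]
  -- Admissibility of ρY lifts f ∘ ρX restricted to the names of points of the piece β.
  have hlift : ∀ β, ∃ G : Baire →. Baire, PartialContinuous G ∧
      ∀ p, ∀ x ∈ ρX p, x ∈ diffPiece U β → ∃ q ∈ G p, f x ∈ ρY q := by
    intro β
    have hmem : ∀ {p : Baire} {y : Y},
        y ∈ pfunOfGraph (fun (p : Baire) y => ∃ x ∈ ρX p, x ∈ diffPiece U β ∧ f x = y) p ↔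
          ∃ x ∈ ρX p, x ∈ diffPiece U β ∧ f x = y := by
      refine mem_pfunOfGraph ?_
      rintro p _ _ ⟨x, hx, -, rfl⟩ ⟨x', hx', -, rfl⟩
      rw [Part.mem_unique hx hx']
    generalize pfunOfGraph (fun (p : Baire) y => ∃ x ∈ ρX p, x ∈ diffPiece U β ∧ f x = y) = g
      at hmem
    have hg : PartialContinuous g := by
      refine partialContinuous_iff.2 fun V hV => ?_
      obtain ⟨O, hO, hOV⟩ := continuousOn_iff'.1 (hf β) V hV
      obtain ⟨T, hT, hTO⟩ := partialContinuous_iff.1 hρX O hO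
      refine ⟨T, hT, fun p y hy => ?_⟩
      obtain ⟨x, hx, hxD, rfl⟩ := hmem.1 hy
      rw [hTO p x hx]
      have := Set.ext_iff.1 hOV x
      simp only [mem_inter_iff, mem_preimage, hxD, and_true] at this
      exact this.symm
    obtain ⟨G, hG, rfl⟩ := hρY.lift g hg
    exact ⟨G, hG, fun p x hx hxD => mem_comp_iff.1 (hmem.2 ⟨x, hx, hxD, rfl⟩)⟩
  choose G hG hGY using hlift
  have hWU : ∀ {p x β}, x ∈ ρX p → p ∈ W β → (∀ γ < β, p ∉ W γ) → x ∈ diffPiece U β :=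
    fun {p x β} hx hβ hlt => hpiece.2 ⟨(hW β p x hx).1 hβ, fun γ hγ hxγ =>
      hlt γ hγ ((hW γ p x hx).2 hxγ)⟩
  have hcover : ∀ {p x}, x ∈ ρX p → ∃ β, p ∈ W β := fun {p x} hx => by
    obtain ⟨β, hβ⟩ := mem_iUnion.1 (hcov.symm ▸ mem_univ x : x ∈ ⋃ β, diffPiece U β)
    exact ⟨β, (hW β p x hx).2 hβ.1⟩
  -- For α = 0 there are no pieces, so no names either, and the nowhere defined function is a
  -- realizer.
  rcases isEmpty_or_nonempty (Iio α) with hα | hα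
  · have hρ : ∀ p x, x ∉ ρX p := fun p x hx => (hcover hx).elim fun β _ => hα.elim β
    refine ⟨fun _ => Part.none, partialContinuous_iff.2 fun V _ => ⟨∅, isOpen_empty, by simp⟩,
      realizes_iff.2 fun p y => ?_⟩
    have hnone : ∀ w, w ∉ (jump α enc).comp (fun _ => Part.none) p := fun w hw =>
      (mem_comp_iff.1 hw).elim fun q hq => Part.notMem_none q hq.1
    simp [hρ, hnone]
  obtain ⟨b, ξ, hanti, hlim, hloc⟩ := exists_descending_guesses (D := {p | (ρX p).Dom}) hWo
    (fun p hp => hcover (Part.get_mem hp)) hG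
    (fun p hp β hβ hlt => by
      have hx := Part.get_mem hp
      obtain ⟨q, hq, -⟩ := hGY β p _ hx (hWU hx hβ hlt)
      exact Part.dom_iff_mem.2 ⟨q, hq⟩)
  let Φ : Baire → Baire := fun p m =>
    Nat.casesOn (Nat.unpair m).2 (enc (b p (Nat.unpair m).1)) (ξ p (b p (Nat.unpair m).1))
  have hterm : ∀ p n, term (Φ p) n 0 = enc (b p n) := fun p n => by simp [term, Φ]
  have hguess : ∀ p n, guess (Φ p) n = ξ p (b p n) := fun p n => by
    funext k
    simp [guess, term, Φ]
  have hcont : ∀ p, (ρX p).Dom → ContinuousAt Φ p := by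
    intro p hp
    refine continuousAt_pi.2 fun m => ?_
    -- Digit 0 of a term is the code and digit k + 1 is digit k of the guess; at digit 0 only the
    -- index equality is used.
    obtain ⟨t, ht⟩ := hloc p hp (Nat.unpair m).1 ((Nat.unpair m).2 - 1)
    refine (continuousAt_const (y := Φ p m)).congr ?_
    filter_upwards [(PiNat.isOpen_cylinder _ p t).mem_nhds (PiNat.self_mem_cylinder p t)]
      with p' hp'
    obtain ⟨hb, hξ⟩ := ht p' hp'
    simp only [Φ]
    generalize (Nat.unpair m).2 = k at hξ
    cases k with
    | zero => exact (congrArg enc hb).symm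
    | succ k => exact hξ.symm
  -- Φ is total, whereas a realizer must have no value outside the domain of ρX, so it is restricted
  -- to that domain.
  have hmem : ∀ {p q : Baire},
      q ∈ pfunOfGraph (fun p q => (ρX p).Dom ∧ Φ p = q) p ↔ (ρX p).Dom ∧ Φ p = q :=
    mem_pfunOfGraph fun p q q' h h' => h.2.symm.trans h'.2
  have hjump : ∀ p, ∀ x ∈ ρX p, ∃ w ∈ jump α enc (Φ p), f x ∈ ρY w := by
    intro p x hx
    have hp : (ρX p).Dom := Part.dom_iff_mem.2 ⟨x, hx⟩
    obtain ⟨N, β, hN, hβ, hlt, hξ⟩ := hlim p hp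
    obtain ⟨q, hq, hy⟩ := hGY β p x hx (hWU hx hβ hlt)
    obtain rfl := Part.mem_unique hξ hq
    refine ⟨ξ p β, mem_jump_iff.2 ⟨⟨b p, hterm p, fun n => hanti p hp n.le_succ, fun n hn hb =>
      hn ?_⟩, N, fun n hn => ?_⟩, hy⟩
    · rw [hguess, hguess, hb]
    · rw [hguess, hN n hn]
  generalize pfunOfGraph (fun p q => (ρX p).Dom ∧ Φ p = q) = F at hmem
  -- Φ is known to be continuous only at names, so the preimage of V need not be open; its interior
  -- contains all names in it.
  refine ⟨F, partialContinuous_iff.2 fun V hV => ⟨interior (Φ ⁻¹' V), isOpen_interior, ?_⟩,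
    realizes_iff.2 fun p y => ?_⟩
  · intro p q hq
    obtain ⟨hp, rfl⟩ := hmem.1 hq
    exact ⟨fun h => interior_subset (s := Φ ⁻¹' V) h, fun h =>
      mem_interior_iff_mem_nhds.2 (hcont p hp (hV.mem_nhds h))⟩
  · constructor
    · rintro ⟨x, hx, rfl⟩
      obtain ⟨w, hw, hy⟩ := hjump p x hx
      exact ⟨w, mem_comp_iff.2 ⟨Φ p, hmem.2 ⟨Part.dom_iff_mem.2 ⟨x, hx⟩, rfl⟩, hw⟩, hy⟩
    · rintro ⟨w, hw, hy⟩
      obtain ⟨q, hq, hwq⟩ := mem_comp_iff.1 hw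
      obtain ⟨hp, rfl⟩ := hmem.1 hq
      have hx := Part.get_mem hp
      obtain ⟨w', hw', hy'⟩ := hjump p _ hx
      obtain rfl := Part.mem_unique hwq hw'
      exact ⟨_, hx, Part.mem_unique hy' hy⟩

end LevelsOfDiscontinuity

theorem theorem21 {X : Type u} {Y : Type v}
    [TopologicalSpace X] [T0Space X] [SecondCountableTopology X]
    [TopologicalSpace Y] [T0Space Y] [SecondCountableTopology Y]
    (ρX : Baire →. X) (hρX : IsAdmissible ρX)
    (ρY : Baire →. Y) (hρY : IsAdmissible ρY)
    (f : X → Y) (α : Ordinal.{u}) (hα : α < Ordinal.omega.{u} 1)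
    (enc : Set.Iio α → ℕ) (henc : Function.Injective enc) :
    (JRealizable ρX ρY (jump α enc) f ↔ Lev f ≤ (α : WithTop Ordinal.{u})) ∧
      (Lev f ≤ (α : WithTop Ordinal.{u}) ↔ DPiecewiseContinuous α f) :=
  ⟨⟨fun h => (lev_le_iff_dPiecewiseContinuous f α).2
      (h.dPiecewiseContinuous hρX hρY.continuous henc),
    fun h => ((lev_le_iff_dPiecewiseContinuous f α).1 h).jRealizable hρX.continuous hρY enc⟩,
    lev_le_iff_dPiecewiseContinuous f α⟩
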